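/- All tournaments are finite. The chromatic number $\chi(G)$ of a tournament $G$ is the minimum $k$ such that $V(G)$ is the union of $k$ subsets each inducing an acyclic subtournament. For a tournament $H$, a tournament is $H$-free if none of its subtournaments is isomorphic to $H$; and $H$ is a \emph{hero} if for some $c>0$, every $H$-free tournament has chromatic number less than $c$. If $H_1,H_2$ are heroes, and $H$ is the tournament obtained from the disjoint union of $H_1$ and $H_2$ by making $V(H_1)$ complete to $V(H_2)$ (that is, by adding all edges directed from a vertex of $H_1$ to a vertex of $H_2$), then $H$ is a hero. -/

import Mathlib

/-- A tournament with vertex set `V`: a loopless digraph in which, for every two distinct vertices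
`u`, `v`, exactly one of the edges `u → v`, `v → u` is present. -/
structure Tournament (V : Type*) extends Digraph V where
  irrefl : ∀ v, ¬ Adj v v
  adj_iff_not : ∀ u v, u ≠ v → (Adj u v ↔ ¬ Adj v u)

namespace Tournament

/-- The subtournament `G[A]` induced on a set `A` of vertices. -/
def induce {V : Type*} (G : Tournament V) (A : Set V) : Tournament A where
  Adj u v := G.Adj u v
  irrefl v := G.irrefl v
  adj_iff_not u v h := G.adj_iff_not u v (fun e => h (Subtype.ext e))

/-- `G` has no directed cycle. -/
def IsAcyclic {V : Type*} (G : Tournament V) : Prop :=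
  ∀ v, ¬ Relation.TransGen G.Adj v v

/-- `V(G)` is the union of `k` subsets that each induce an acyclic subtournament. -/
def Colorable {V : Type*} (G : Tournament V) (k : ℕ) : Prop :=
  ∃ A : Fin k → Set V, (⋃ i, A i) = Set.univ ∧ ∀ i, (G.induce (A i)).IsAcyclic

/-- The chromatic number: the minimum `k` such that `V(G)` is the union of `k` subsets that each
induce an acyclic subtournament (`⊤` if there is no such `k`, which cannot happen for finite `V`). -/
noncomputable def chromaticNumber {V : Type*} (G : Tournament V) : ℕ∞ :=
  ⨅ k ∈ {k : ℕ | G.Colorable k}, (k : ℕ∞)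

/-- `G` is `H`-free: no subtournament of `G` is isomorphic to `H`. -/
def IsFree {V W : Type*} (G : Tournament V) (H : Tournament W) : Prop :=
  ¬ ∃ S : Set V, Nonempty (H.Adj ≃r (G.induce S).Adj)

/-- `H` is a hero: for some `c > 0`, every (finite) `H`-free tournament has chromatic number less
than `c`. As every finite type is equivalent to one in `Type`, quantifying over `Type` covers all
finite tournaments up to isomorphism. -/
def IsHero {W : Type*} (H : Tournament W) : Prop :=
  ∃ c : ℕ, 0 < c ∧
    ∀ (V : Type) [Finite V] (G : Tournament V), G.IsFree H → G.chromaticNumber < (c : ℕ∞)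

/-- The tournament obtained from the disjoint union of `H₁` and `H₂` by making `V(H₁)` complete to
`V(H₂)`, that is, by adding all edges from vertices of `H₁` to vertices of `H₂`. -/
def completeJoin {V₁ V₂ : Type*} (H₁ : Tournament V₁) (H₂ : Tournament V₂) :
    Tournament (V₁ ⊕ V₂) where
  Adj := Sum.Lex H₁.Adj H₂.Adj
  irrefl v := by
    cases v with
    | inl a => simpa using H₁.irrefl a
    | inr b => simpa using H₂.irrefl b
  adj_iff_not u v h := by
    cases u <;> cases v <;> simp only [ne_eq, Sum.inl.injEq, Sum.inr.injEq] at h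
    · simpa using H₁.adj_iff_not _ _ h
    · simp
    · simp
    · simpa using H₂.adj_iff_not _ _ h

end Tournament

namespace Tournament

variable {V : Type*} {G : Tournament V}

/-! Let `G` be free of the join. A set of large chromatic number contains a copy of `H₁`, whose
common out-neighbourhood contains no `H₂` and so is `c`-colorable; dually for `H₂` and
in-neighbourhoods. Suppose `G` has a set `S`, of size bounded independently of `G`, that is not
`(2c+1)`-colorable. For each `v`, the in- or the out-neighbours of `v` in `S` are not `c`-colorable.
So `v` lies in the `c`-colorable common neighbourhood of one of boundedly many copies in `S`, which
bounds the chromatic number of `G`. Such an `S` is built by induction inside a clique of heavy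
edges: a colour used at both ends of an edge cannot occur among the vertices completing it to a
cyclic triangle. -/

lemma Adj.asymm {u v : V} (h : G.Adj u v) : ¬ G.Adj v u := by
  have hne : u ≠ v := by rintro rfl; exact G.irrefl _ h
  exact (G.adj_iff_not u v hne).1 h

lemma adj_or_adj {u v : V} (h : u ≠ v) : G.Adj u v ∨ G.Adj v u := by
  by_cases hv : G.Adj v u
  · exact Or.inr hv
  · exact Or.inl ((G.adj_iff_not u v h).2 hv)

/-- The induced subtournament `G[X]` is covered by `k` acyclic sets. -/
def ColorableOn (G : Tournament V) (X : Set V) (k : ℕ) : Prop :=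
  ∃ A : Fin k → Set V, X ⊆ ⋃ i, A i ∧ ∀ i, (G.induce (A i)).IsAcyclic

lemma isAcyclic_induce_of_subsingleton {A : Set V} (hA : A.Subsingleton) :
    (G.induce A).IsAcyclic := by
  intro v hv
  obtain ⟨w, hw, -⟩ := Relation.TransGen.head'_iff.1 hv
  have : w = v := Subtype.ext (hA w.2 v.2)
  subst this
  exact (G.induce A).irrefl _ hw

lemma IsAcyclic.not_mem_of_cyclicTriangle {A : Set V} (hA : (G.induce A).IsAcyclic) {u v w : V}
    (hu : u ∈ A) (hv : v ∈ A) (huv : G.Adj u v) (hvw : G.Adj v w) (hwu : G.Adj w u) : w ∉ A := by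
  intro hw
  have h₁ : (G.induce A).Adj ⟨u, hu⟩ ⟨v, hv⟩ := huv
  have h₂ : (G.induce A).Adj ⟨v, hv⟩ ⟨w, hw⟩ := hvw
  have h₃ : (G.induce A).Adj ⟨w, hw⟩ ⟨u, hu⟩ := hwu
  exact hA _ (.head h₁ (.head h₂ (.single h₃)))

lemma IsAcyclic.of_hom {W : Type*} {G' : Tournament W} (hG : G.IsAcyclic) (f : W → V)
    (hf : ∀ a b, G'.Adj a b → G.Adj (f a) (f b)) : G'.IsAcyclic :=
  fun v hv => hG (f v) (hv.lift f hf)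

lemma ColorableOn.of_cover {X : Set V} {k : ℕ} {ι : Type*} [Finite ι] (hk : Nat.card ι ≤ k)
    (A : ι → Set V) (hX : X ⊆ ⋃ i, A i) (hA : ∀ i, (G.induce (A i)).IsAcyclic) :
    G.ColorableOn X k := by
  let e := Finite.equivFin ι
  refine ⟨fun j => if h : j.1 < Nat.card ι then A (e.symm ⟨j, h⟩) else ∅, ?_, ?_⟩
  · intro x hx
    obtain ⟨i, hi⟩ := Set.mem_iUnion.1 (hX hx)
    refine Set.mem_iUnion.2 ⟨⟨e i, (e i).2.trans_le hk⟩, ?_⟩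
    simpa using hi
  · intro j
    dsimp only
    by_cases h : j.1 < Nat.card ι
    · rw [dif_pos h]
      exact hA _
    · rw [dif_neg h]
      exact isAcyclic_induce_of_subsingleton Set.subsingleton_empty

lemma ColorableOn.mono {X Y : Set V} {k l : ℕ} (h : G.ColorableOn Y l) (hXY : X ⊆ Y)
    (hkl : l ≤ k) : G.ColorableOn X k := by
  obtain ⟨A, hA, hA'⟩ := h
  exact .of_cover (by simpa using hkl) A (hXY.trans hA) hA'

lemma ColorableOn.union {X Y : Set V} {k l : ℕ} (hX : G.ColorableOn X k)
    (hY : G.ColorableOn Y l) : G.ColorableOn (X ∪ Y) (k + l) := by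
  obtain ⟨A, hA, hA'⟩ := hX
  obtain ⟨B, hB, hB'⟩ := hY
  refine .of_cover (ι := Fin k ⊕ Fin l) (by simp) (Sum.elim A B) ?_ ?_
  · rw [Set.iUnion_sum]
    exact Set.union_subset_union hA hB
  · rintro (i | i)
    · exact hA' i
    · exact hB' i

lemma ColorableOn.iUnion {ι : Type*} [Finite ι] {X : ι → Set V} {k : ℕ}
    (hX : ∀ i, G.ColorableOn (X i) k) : G.ColorableOn (⋃ i, X i) (Nat.card ι * k) := by
  choose A hA hA' using hX
  refine .of_cover (ι := ι × Fin k) (by simp) (fun p => A p.1 p.2) ?_ fun p => hA' _ _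
  refine Set.iUnion_subset fun i x hx => ?_
  obtain ⟨j, hj⟩ := Set.mem_iUnion.1 (hA i hx)
  exact Set.mem_iUnion.2 ⟨(i, j), hj⟩

lemma colorableOn_singleton (v : V) : G.ColorableOn {v} 1 :=
  .of_cover (ι := Unit) (by simp) (fun _ => {v}) (by simp)
    fun _ => isAcyclic_induce_of_subsingleton Set.subsingleton_singleton

lemma colorableOn_empty (k : ℕ) : G.ColorableOn ∅ k :=
  .of_cover (ι := Empty) (by simp) (fun _ => ∅) (by simp) (by simp)

/-! ### Neighbourhood bounds and heavy cliques -/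

/-- Outside of a colorable set there are always finite patterns `f : α → V` whose common
out-neighbourhood has small chromatic number. -/
def OutBounded (G : Tournament V) (α : Type*) (c : ℕ) : Prop :=
  ∀ X, ¬ G.ColorableOn X c →
    ∃ f : α → V, (∀ a, f a ∈ X) ∧ G.ColorableOn {v | ∀ a, G.Adj (f a) v} c

/-- The analogue of `OutBounded` for common in-neighbourhoods. -/
def InBounded (G : Tournament V) (α : Type*) (c : ℕ) : Prop :=
  ∀ X, ¬ G.ColorableOn X c →
    ∃ f : α → V, (∀ a, f a ∈ X) ∧ G.ColorableOn {v | ∀ a, G.Adj v (f a)} c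

/-- The vertices of `X` forming a cyclic triangle with the edge `u → v`. -/
def triangleSet (G : Tournament V) (X : Set V) (u v : V) : Set V :=
  {w | w ∈ X ∧ G.Adj v w ∧ G.Adj w u}

/-- `u` and `v` are joined by an edge whose `triangleSet` in `X` is not `K`-colorable. -/
def Heavy (G : Tournament V) (X : Set V) (K : ℕ) (u v : V) : Prop :=
  (G.Adj u v ∧ ¬ G.ColorableOn (G.triangleSet X u v) K) ∨
    (G.Adj v u ∧ ¬ G.ColorableOn (G.triangleSet X v u) K)

lemma Heavy.symm {X : Set V} {K : ℕ} {u v : V} (h : G.Heavy X K u v) : G.Heavy X K v u :=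
  Or.symm h

section Bounded

variable {α β : Type*} [Finite α] [Finite β] {c K B : ℕ} {X Y : Set V}

/-- If the light in-neighbours of `s` contain a pattern `f`, an out-neighbour of `s` that is not
dominated by all of `f` closes a cyclic triangle on some light edge `f a → s`. -/
lemma colorableOn_inter_in_or_out (hα : G.OutBounded α c) (hYX : Y ⊆ X) {s : V}
    (hB : G.ColorableOn {x | x ∈ Y ∧ G.Heavy X K s x} B) :
    G.ColorableOn {x | x ∈ Y ∧ G.Adj x s} (B + c) ∨
      G.ColorableOn {x | x ∈ Y ∧ G.Adj s x} (Nat.card α * K + c) := by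
  by_cases hL : G.ColorableOn
      {x | x ∈ Y ∧ G.Adj x s ∧ G.ColorableOn (G.triangleSet X x s) K} c
  · refine Or.inl ((hB.union hL).mono ?_ le_rfl)
    rintro x ⟨hx, hxs⟩
    by_cases hcol : G.ColorableOn (G.triangleSet X x s) K
    · exact Or.inr ⟨hx, hxs, hcol⟩
    · exact Or.inl ⟨hx, Or.inr ⟨hxs, hcol⟩⟩
  · obtain ⟨f, hf, hf'⟩ := hα _ hL
    refine Or.inr (((ColorableOn.iUnion fun a => (hf a).2.2).union hf').mono ?_ le_rfl)
    rintro x ⟨hx, hsx⟩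
    by_cases hall : ∀ a, G.Adj (f a) x
    · exact Or.inr hall
    · push Not at hall
      obtain ⟨a, ha⟩ := hall
      have hne : f a ≠ x := by
        rintro rfl
        exact Adj.asymm hsx (hf a).2.1
      exact Or.inl (Set.mem_iUnion.2 ⟨a, hYX hx, hsx, (adj_or_adj hne).resolve_left ha⟩)

lemma OutBounded.colorableOn_of_in {D : ℕ} (hα : G.OutBounded α c) {P : Set V}
    (hP : ¬ G.ColorableOn P c) (hD : ∀ s ∈ P, G.ColorableOn {x | x ∈ Y ∧ G.Adj x s} D) :
    G.ColorableOn Y (Nat.card α * (D + 1) + c) := by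
  obtain ⟨f, hf, hf'⟩ := hα _ hP
  -- The singleton accounts for `f a` itself, hence `D + 1`.
  refine ((ColorableOn.iUnion fun a =>
    (hD _ (hf a)).union (colorableOn_singleton (f a))).union hf').mono (fun x hx => ?_) le_rfl
  by_cases hall : ∀ a, G.Adj (f a) x
  · exact Or.inr hall
  · push Not at hall
    obtain ⟨a, ha⟩ := hall
    refine Or.inl (Set.mem_iUnion.2 ⟨a, ?_⟩)
    by_cases hne : f a = x
    · exact Or.inr hne.symm
    · exact Or.inl ⟨hx, (adj_or_adj hne).resolve_left ha⟩

lemma InBounded.colorableOn_of_out {D : ℕ} (hβ : G.InBounded β c) {Q : Set V}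
    (hQ : ¬ G.ColorableOn Q c) (hD : ∀ s ∈ Q, G.ColorableOn {x | x ∈ Y ∧ G.Adj s x} D) :
    G.ColorableOn Y (Nat.card β * (D + 1) + c) := by
  obtain ⟨f, hf, hf'⟩ := hβ _ hQ
  refine ((ColorableOn.iUnion fun a =>
    (hD _ (hf a)).union (colorableOn_singleton (f a))).union hf').mono (fun x hx => ?_) le_rfl
  by_cases hall : ∀ a, G.Adj x (f a)
  · exact Or.inr hall
  · push Not at hall
    obtain ⟨a, ha⟩ := hall
    refine Or.inl (Set.mem_iUnion.2 ⟨a, ?_⟩)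
    by_cases hne : x = f a
    · exact Or.inr hne
    · exact Or.inl ⟨hx, (adj_or_adj hne).resolve_left ha⟩

/-- The bound obtained in `colorableOn_of_heavy_nbhd`. -/
def lightBound (a b c K B : ℕ) : ℕ :=
  (a * (B + c + a * K + 1) + c) + (b * (B + c + a * K + 1) + c)

/-- Every vertex of `Y` has a small in- or out-neighbourhood in `Y`. If either kind of vertex is not
`c`-colorable, a pattern among them covers `Y` cheaply. -/
lemma colorableOn_of_heavy_nbhd (hα : G.OutBounded α c) (hβ : G.InBounded β c) (hYX : Y ⊆ X)
    (hB : ∀ s ∈ Y, G.ColorableOn {x | x ∈ Y ∧ G.Heavy X K s x} B) :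
    G.ColorableOn Y (lightBound (Nat.card α) (Nat.card β) c K B) := by
  set D := B + c + Nat.card α * K with hD
  have hbound : lightBound (Nat.card α) (Nat.card β) c K B =
      (Nat.card α * (D + 1) + c) + (Nat.card β * (D + 1) + c) := rfl
  by_cases hP : G.ColorableOn {s | s ∈ Y ∧ G.ColorableOn {x | x ∈ Y ∧ G.Adj x s} D} c
  · by_cases hQ : G.ColorableOn {s | s ∈ Y ∧ G.ColorableOn {x | x ∈ Y ∧ G.Adj s x} D} c
    · refine (hP.union hQ).mono (fun s hs => ?_) (by omega)
      rcases colorableOn_inter_in_or_out hα hYX (hB s hs) with h | h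
      · exact Or.inl ⟨hs, h.mono subset_rfl (by omega)⟩
      · exact Or.inr ⟨hs, h.mono subset_rfl (by omega)⟩
    · exact (hβ.colorableOn_of_out hQ fun s hs => hs.2).mono subset_rfl
        (by omega)
  · exact (hα.colorableOn_of_in hP fun s hs => hs.2).mono subset_rfl
      (by omega)

/-- The bound for sets without heavy cliques of size `r`. -/
def cliqueBound (a b c K : ℕ) : ℕ → ℕ
  | 0 => 0
  | r + 1 => lightBound a b c K (cliqueBound a b c K r)

lemma exists_heavy_clique (hα : G.OutBounded α c) (hβ : G.InBounded β c) (r : ℕ)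
    (hYX : Y ⊆ X) (hY : ¬ G.ColorableOn Y (cliqueBound (Nat.card α) (Nat.card β) c K r)) :
    ∃ q : Fin r → V, (∀ i, q i ∈ Y) ∧ ∀ i j, i ≠ j → G.Heavy X K (q i) (q j) := by
  induction r generalizing Y with
  | zero => exact ⟨Fin.elim0, fun i => i.elim0, fun i => i.elim0⟩
  | succ r ih =>
    by_contra hno
    refine hY (colorableOn_of_heavy_nbhd hα hβ hYX fun s hs => ?_)
    by_contra hcol
    obtain ⟨q, hq, hq'⟩ := ih (fun x hx => hYX hx.1) hcol
    refine hno ⟨Fin.cons s q, fun i => ?_, fun i j => ?_⟩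
    · cases i using Fin.cases with
      | zero => exact hs
      | succ i => exact (hq i).1
    · cases i using Fin.cases with
      | zero =>
        cases j using Fin.cases with
        | zero => exact fun h => (h rfl).elim
        | succ j => exact fun _ => (hq j).2
      | succ i =>
        cases j using Fin.cases with
        | zero => exact fun _ => (hq i).2.symm
        | succ j => exact fun h => hq' i j fun e => h (by rw [e])

end Bounded

/-! ### Bounded subsets of large chromatic number -/

lemma ColorableOn.triangle {r : ℕ} {A : Fin (r + 1) → Set V}
    (hA : ∀ i, (G.induce (A i)).IsAcyclic) {t : Fin (r + 1)} {u v : V} (hu : u ∈ A t)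
    (hv : v ∈ A t) (huv : G.Adj u v) {X Z : Set V} (hZ : Z ⊆ G.triangleSet X u v)
    (hZA : Z ⊆ ⋃ i, A i) : G.ColorableOn Z r := by
  refine ⟨fun i => A (t.succAbove i), fun z hz => ?_, fun i => hA _⟩
  obtain ⟨j, hj⟩ := Set.mem_iUnion.1 (hZA hz)
  have hjt : j ≠ t := by
    rintro rfl
    exact (hA j).not_mem_of_cyclicTriangle hu hv huv (hZ hz).2.1 (hZ hz).2.2 hj
  obtain ⟨i, rfl⟩ := Fin.exists_succAbove_eq hjt
  exact Set.mem_iUnion.2 ⟨i, hj⟩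

/-- `ι` and `K` are chosen before `G`, so the final bound is uniform in `G`. -/
lemma exists_bounded_subset_not_colorableOn (α β : Type*) [Finite α] [Finite β] (c r : ℕ) :
    ∃ (ι : Type) (_ : Finite ι) (K : ℕ), ∀ {V : Type} (G : Tournament V), G.OutBounded α c →
      G.InBounded β c → ∀ X, ¬ G.ColorableOn X K →
        ∃ g : ι → V, (∀ i, g i ∈ X) ∧ ¬ G.ColorableOn (Set.range g) r := by
  induction r with
  | zero =>
    refine ⟨Unit, inferInstance, 0, fun G _ _ X hX => ?_⟩
    obtain ⟨x, hx⟩ : X.Nonempty := by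
      rw [Set.nonempty_iff_ne_empty]
      rintro rfl
      exact hX (colorableOn_empty 0)
    refine ⟨fun _ => x, fun _ => hx, ?_⟩
    rintro ⟨A, hA, -⟩
    simpa using hA ⟨(), rfl⟩
  | succ r ih =>
    obtain ⟨ι, hι, K, hK⟩ := ih
    -- The heavy clique has one vertex more than there are colours; each ordered pair also carries a
    -- non-`r`-colorable set from its triangles.
    refine ⟨Fin (r + 2) ⊕ (Fin (r + 2) × Fin (r + 2)) × ι, inferInstance,
      cliqueBound (Nat.card α) (Nat.card β) c K (r + 2), fun {V} G hα hβ X hX => ?_⟩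
    obtain ⟨q, hqX, hq⟩ := exists_heavy_clique hα hβ (r + 2) subset_rfl hX
    have key : ∀ p : Fin (r + 2) × Fin (r + 2), ∃ g : ι → V, (∀ i, g i ∈ X) ∧
        (G.Adj (q p.1) (q p.2) → p.1 ≠ p.2 → (∀ i, g i ∈ G.triangleSet X (q p.1) (q p.2)) ∧
          ¬ G.ColorableOn (Set.range g) r) := by
      rintro ⟨i, j⟩
      by_cases h : G.Adj (q i) (q j) ∧ i ≠ j
      · have hnot : ¬ G.ColorableOn (G.triangleSet X (q i) (q j)) K := by
          rcases hq i j h.2 with h' | h'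
          · exact h'.2
          · exact absurd h'.1 (Adj.asymm h.1)
        obtain ⟨g, hg, hg'⟩ := hK G hα hβ _ hnot
        exact ⟨g, fun i => (hg i).1, fun _ _ => ⟨hg, hg'⟩⟩
      -- Dummy value for pairs that are not edges.
      · exact ⟨fun _ => q 0, fun _ => hqX 0, fun h₁ h₂ => absurd ⟨h₁, h₂⟩ h⟩
    choose g hgX hg using key
    refine ⟨Sum.elim q fun p => g p.1 p.2, ?_, ?_⟩
    · rintro (i | p)
      · exact hqX i
      · exact hgX _ _
    rintro ⟨A, hA, hA'⟩
    have hcol : ∀ i, ∃ t, q i ∈ A t := fun i => Set.mem_iUnion.1 (hA ⟨Sum.inl i, rfl⟩)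
    choose t ht using hcol
    have main : ∀ i j, i ≠ j → t i = t j → ¬ G.Adj (q i) (q j) := by
      intro i j hij htij hadj
      obtain ⟨h₁, h₂⟩ := hg (i, j) hadj hij
      refine h₂ (ColorableOn.triangle hA' (ht i) (htij ▸ ht j) hadj
        (Set.range_subset_iff.2 h₁) ?_)
      rintro _ ⟨x, rfl⟩
      exact hA ⟨Sum.inr ((i, j), x), rfl⟩
    obtain ⟨i, j, hij, htij⟩ := Fintype.exists_ne_map_eq_of_card_lt t (by simp)
    rcases hq i j hij with h | h
    · exact main i j hij htij h.1
    · exact main j i hij.symm htij.symm h.1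

lemma colorableOn_univ_of_range {α β ι : Type*} [Finite α] [Finite β] [Finite ι] {c : ℕ}
    (hα : G.OutBounded α c) (hβ : G.InBounded β c) (g : ι → V)
    (hg : ¬ G.ColorableOn (Set.range g) (c + c + 1)) :
    G.ColorableOn Set.univ (Nat.card (α → ι) * c + Nat.card (β → ι) * c) := by
  -- Patterns with a common neighbourhood that is not `c`-colorable contribute the empty set, so all
  -- maps `h` can be summed over.
  have hX : ∀ h : α → ι, G.ColorableOn {v | G.ColorableOn {v | ∀ a, G.Adj (g (h a)) v} c ∧
      ∀ a, G.Adj (g (h a)) v} c := by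
    intro h
    by_cases hc : G.ColorableOn {v | ∀ a, G.Adj (g (h a)) v} c
    · exact hc.mono (fun v hv => hv.2) le_rfl
    · exact (colorableOn_empty c).mono (fun v hv => hc hv.1) le_rfl
  have hY : ∀ h : β → ι, G.ColorableOn {v | G.ColorableOn {v | ∀ a, G.Adj v (g (h a))} c ∧
      ∀ a, G.Adj v (g (h a))} c := by
    intro h
    by_cases hc : G.ColorableOn {v | ∀ a, G.Adj v (g (h a))} c
    · exact hc.mono (fun v hv => hv.2) le_rfl
    · exact (colorableOn_empty c).mono (fun v hv => hc hv.1) le_rfl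
  refine ((ColorableOn.iUnion hX).union (ColorableOn.iUnion hY)).mono (fun v _ => ?_) le_rfl
  by_cases h₁ : G.ColorableOn {x | x ∈ Set.range g ∧ G.Adj x v} c
  · by_cases h₂ : G.ColorableOn {x | x ∈ Set.range g ∧ G.Adj v x} c
    · refine absurd (((h₁.union h₂).union (colorableOn_singleton v)).mono ?_ le_rfl) hg
      intro x hx
      by_cases hxv : x = v
      · exact Or.inr hxv
      · exact Or.inl ((adj_or_adj hxv).imp (fun h => ⟨hx, h⟩) fun h => ⟨hx, h⟩)
    · obtain ⟨f, hf, hf'⟩ := hβ _ h₂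
      choose h hh using fun b => (hf b).1
      obtain rfl : (fun b => g (h b)) = f := funext hh
      exact Or.inr (Set.mem_iUnion.2 ⟨h, hf', fun b => (hf b).2⟩)
  · obtain ⟨f, hf, hf'⟩ := hα _ h₁
    choose h hh using fun b => (hf b).1
    obtain rfl : (fun b => g (h b)) = f := funext hh
    exact Or.inl (Set.mem_iUnion.2 ⟨h, hf', fun b => (hf b).2⟩)

/-! ### From heroes to patterns -/

lemma chromaticNumber_lt_iff {c : ℕ} :
    G.chromaticNumber < (c : ℕ∞) ↔ ∃ k < c, G.Colorable k := by
  simp [chromaticNumber, iInf_lt_iff, and_comm]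

lemma Colorable.colorableOn {X : Set V} {k : ℕ} (h : (G.induce X).Colorable k) :
    G.ColorableOn X k := by
  obtain ⟨A, hA, hA'⟩ := h
  refine ⟨fun i => (↑) '' A i, fun x hx => ?_, fun i => ?_⟩
  · obtain ⟨i, hi⟩ := Set.mem_iUnion.1 (hA ▸ Set.mem_univ (⟨x, hx⟩ : X))
    exact Set.mem_iUnion.2 ⟨i, _, hi, rfl⟩
  · have hmem : ∀ x : ((↑) '' A i : Set V), ∃ y : A i, (y.1 : V) = x := by
      rintro ⟨_, y, hy, rfl⟩
      exact ⟨⟨y, hy⟩, rfl⟩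
    choose f hf using hmem
    refine (hA' i).of_hom f fun a b hab => ?_
    change G.Adj _ _
    rw [hf, hf]
    exact hab

lemma ColorableOn.colorable {k : ℕ} (h : G.ColorableOn Set.univ k) : G.Colorable k := by
  obtain ⟨A, hA, hA'⟩ := h
  exact ⟨A, Set.univ_subset_iff.1 hA, hA'⟩

lemma not_isFree_of_relEmbedding {W : Type*} {H : Tournament W} (φ : H.Adj ↪r G.Adj) :
    ¬ G.IsFree H := by
  refine not_not.2 ⟨Set.range φ, ⟨⟨Equiv.ofInjective φ φ.injective, ?_⟩⟩⟩
  intro a b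
  exact φ.map_rel_iff

/-- A map preserving edges is an embedding of tournaments. -/
def relEmbeddingOfHom {W : Type*} {H : Tournament W} (f : W → V)
    (hf : ∀ a b, H.Adj a b → G.Adj (f a) (f b)) : H.Adj ↪r G.Adj where
  toFun := f
  inj' a b hab := by
    by_contra hne
    rcases adj_or_adj (G := H) hne with h | h
    · exact G.irrefl (f b) (by simpa [hab] using hf _ _ h)
    · exact G.irrefl (f b) (by simpa [hab] using hf _ _ h)
  map_rel_iff' := by
    intro a b
    refine ⟨fun h => ?_, hf a b⟩
    have hne : a ≠ b := by rintro rfl; exact G.irrefl _ h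
    exact (adj_or_adj hne).resolve_right fun h' => Adj.asymm h (hf _ _ h')

lemma IsHero.exists_hom {W : Type*} {H : Tournament W} (hH : H.IsHero) :
    ∃ c : ℕ, ∀ {V : Type} [Finite V] (G : Tournament V) (X : Set V), ¬ G.ColorableOn X c →
      ∃ f : W → V, (∀ a, f a ∈ X) ∧ ∀ a b, H.Adj a b → G.Adj (f a) (f b) := by
  obtain ⟨c, -, hc⟩ := hH
  refine ⟨c, fun G X hX => ?_⟩
  have hfree : ¬ (G.induce X).IsFree H := by
    intro hfree
    obtain ⟨k, hk, hcol⟩ := chromaticNumber_lt_iff.1 (hc X (G.induce X) hfree)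
    exact hX (hcol.colorableOn.mono subset_rfl hk.le)
  obtain ⟨S, ⟨e⟩⟩ := not_not.1 hfree
  exact ⟨fun a => (e a).1, fun a => (e a).1.2, fun a b hab => e.map_rel_iff.2 hab⟩

end Tournament

open Tournament in
theorem mainTheorem12 {V₁ V₂ : Type*} [Finite V₁] [Finite V₂]
    (H₁ : Tournament V₁) (H₂ : Tournament V₂) (h₁ : H₁.IsHero) (h₂ : H₂.IsHero) :
    (H₁.completeJoin H₂).IsHero := by
  obtain ⟨c₁, hc₁⟩ := h₁.exists_hom
  obtain ⟨c₂, hc₂⟩ := h₂.exists_hom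
  set c := max c₁ c₂
  obtain ⟨ι, hι, K, hK⟩ := exists_bounded_subset_not_colorableOn V₁ V₂ c (c + c + 1)
  set N := Nat.card (V₁ → ι) * c + Nat.card (V₂ → ι) * c
  refine ⟨K + N + 1, by omega, fun V _ G hG => chromaticNumber_lt_iff.2 ?_⟩
  have hjoin : ∀ (f₁ : V₁ → V) (f₂ : V₂ → V), (∀ a b, H₁.Adj a b → G.Adj (f₁ a) (f₁ b)) →
      (∀ a b, H₂.Adj a b → G.Adj (f₂ a) (f₂ b)) → ¬ ∀ a b, G.Adj (f₁ a) (f₂ b) := by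
    intro f₁ f₂ hf₁ hf₂ h
    refine not_isFree_of_relEmbedding (H := H₁.completeJoin H₂)
      (relEmbeddingOfHom (Sum.elim f₁ f₂) ?_) hG
    rintro _ _ (hab | hab | _)
    · exact hf₁ _ _ hab
    · exact hf₂ _ _ hab
    · exact h _ _
  have hα : G.OutBounded V₁ c := by
    intro X hX
    obtain ⟨f, hf, hf'⟩ := hc₁ G X fun h => hX (h.mono subset_rfl (le_max_left _ _))
    refine ⟨f, hf, ?_⟩
    by_contra hcol
    obtain ⟨f₂, h, h'⟩ := hc₂ G _ fun h => hcol (h.mono subset_rfl (le_max_right _ _))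
    exact hjoin f f₂ hf' h' fun a b => h b a
  have hβ : G.InBounded V₂ c := by
    intro X hX
    obtain ⟨f, hf, hf'⟩ := hc₂ G X fun h => hX (h.mono subset_rfl (le_max_right _ _))
    refine ⟨f, hf, ?_⟩
    by_contra hcol
    obtain ⟨f₁, h, h'⟩ := hc₁ G _ fun h => hcol (h.mono subset_rfl (le_max_left _ _))
    exact hjoin f₁ f h' hf' h
  by_cases huniv : G.ColorableOn Set.univ K
  · exact ⟨K, by omega, huniv.colorable⟩
  · obtain ⟨g, -, hg⟩ := hK G hα hβ _ huniv
    exact ⟨N, by omega, (colorableOn_univ_of_range hα hβ g hg).colorable⟩
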